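/- Let $d\ge 2$ and $n\ge 1$ be integers, let $\mathcal H=\mathbb C^d$, and let $p_{\rm e}\in(0,\tfrac12)$. Consider the independent erasure channel $$\mathcal C=\bigotimes_{j=1}^{n}\left((1-p_{\rm e})\,\mathcal I+p_{\rm e}\,\mathcal C_{\rm e}\right),$$ where $\mathcal C_{\rm e}$ is the single-qudit erasure channel, which replaces every state of $\mathcal H$ by a fixed flag state $|{\rm e}\rangle\langle {\rm e}|$ orthogonal to $\mathcal H$, so that $\mathcal C$ maps operators on $\mathcal H^{\otimes n}$ to operators on $(\mathcal H\oplus\mathbb C|{\rm e}\rangle)^{\otimes n}$. Let $(\mathcal E_{\rm cov},\mathcal D_{\rm cov})$ be any $SU(d)$-covariant code that encodes one logical qudit into $n$ qudits: $\mathcal E_{\rm cov}$ is a quantum channel from operators on $\mathcal H$ to operators on $\mathcal H^{\otimes n}$, $\mathcal D_{\rm cov}$ is a quantum channel from operators on $(\mathcal H\oplus\mathbb C|{\rm e}\rangle)^{\otimes n}$ to operators on $\mathcal H$, and there is a set $S\subseteq\{1,\dots,n\}$ such that, for every $V\in SU(d)$, with $\mathcal V(\cdot)=V(\cdot)V^\dagger$,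 $$\mathcal E_{\rm cov}\circ\mathcal V=(\mathcal V_1\otimes\cdots\otimes\mathcal V_n)\circ\mathcal E_{\rm cov},$$ where $\mathcal V_i=\mathcal V$ if $i\in S$ and $\mathcal V_i$ is the identity channel if $i\notin S$. Then the error $$\epsilon_{\rm cov}:=\sup_{V\in SU(d)}\tfrac12\left\|\mathcal D_{\rm cov}\circ\mathcal C\circ(\mathcal V_1\otimes\cdots\otimes\mathcal V_n)\circ\mathcal E_{\rm cov}-\mathcal V\right\|_\diamond$$ satisfies $$\epsilon_{\rm cov}\ \ge\ \frac{p_{\rm e}}{64\,n\,(1-p_{\rm e})}.$$ Here $\|\mathcal A-\mathcal B\|_\diamond$ is the supremum, over all finite-dimensional ancilla spaces $\mathcal K'$ and all states $\rho$ of the input and the ancilla, of the trace norm of $(\mathcal A\otimes\mathcal I_{\mathcal K'})(\rho)-(\mathcal B\otimes\mathcal I_{\mathcal K'})(\rho)$. -/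

import Mathlib

open scoped ENNReal ComplexOrder

noncomputable section

namespace CovariantCode

/-- Linear operators on the finite-dimensional Hilbert space `ℂ^a`, in its standard basis. -/
abbrev Op (a : Type*) := Matrix a a ℂ

/-- Density operators: positive semidefinite of trace one. -/
def IsState {a : Type*} [Fintype a] (ρ : Op a) : Prop :=
  ρ.PosSemidef ∧ ρ.trace = 1

/-- The trace norm: the sum of the singular values, that is, of the square roots of the
eigenvalues of `Aᴴ * A`. -/
def traceNorm {a : Type*} [Fintype a] [DecidableEq a] (A : Op a) : ℝ :=
  ∑ i, Real.sqrt ((Matrix.isHermitian_conjTranspose_mul_self A).eigenvalues i)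

/-- The map `Φ ⊗ id` with an ancilla `ℂ^r`: `Φ` is applied to each of the blocks labelled by two
ancilla basis elements. -/
def withAncilla {a b : Type*} (Φ : Op a →ₗ[ℂ] Op b) (r : Type*) :
    Op (a × r) →ₗ[ℂ] Op (b × r) where
  toFun ρ := Matrix.of fun x y => Φ (Matrix.of fun i j => ρ (i, x.2) (j, y.2)) x.1 y.1
  map_add' ρ σ := by
    ext x y
    exact congrFun (congrFun (map_add Φ (Matrix.of fun i j => ρ (i, x.2) (j, y.2))
      (Matrix.of fun i j => σ (i, x.2) (j, y.2))) x.1) y.1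
  map_smul' c ρ := by
    ext x y
    exact congrFun (congrFun (map_smul Φ c (Matrix.of fun i j => ρ (i, x.2) (j, y.2))) x.1) y.1

/-- `Φ ⊗ id` does on product operators what it should. -/
theorem withAncilla_kronecker {a b : Type*} (Φ : Op a →ₗ[ℂ] Op b) {r : Type*}
    (A : Op a) (B : Op r) :
    withAncilla Φ r (Matrix.kronecker A B) = Matrix.kronecker (Φ A) B := by
  ext x y
  have h : (Matrix.of fun i j => Matrix.kronecker A B (i, x.2) (j, y.2)) = B x.2 y.2 • A := by
    ext i j
    simp [mul_comm]
  change Φ (Matrix.of fun i j => Matrix.kronecker A B (i, x.2) (j, y.2)) x.1 y.1 = _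
  rw [h, map_smul]
  simp [mul_comm]

/-- Quantum channels: completely positive and trace-preserving linear maps. -/
structure IsChannel {a b : Type*} [Fintype a] [Fintype b] (Φ : Op a →ₗ[ℂ] Op b) : Prop where
  completelyPositive : ∀ (k : ℕ) (ρ : Op (a × Fin k)),
    ρ.PosSemidef → (withAncilla Φ (Fin k) ρ).PosSemidef
  tracePreserving : ∀ ρ : Op a, (Φ ρ).trace = ρ.trace

/-- The diamond norm error `½ ‖Φ - Ψ‖_⋄`: the supremum, over all finite-dimensional ancillas and
all joint states of the input and the ancilla, of half the trace norm of the difference of the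
two outputs. -/
def diamondError {a b : Type*} [Fintype a] [Fintype b] [DecidableEq b]
    (Φ Ψ : Op a →ₗ[ℂ] Op b) : ℝ≥0∞ :=
  ⨆ (k : ℕ) (ρ : Op (a × Fin k)) (_ : IsState ρ),
    ENNReal.ofReal ((1 / 2 : ℝ) *
      traceNorm (withAncilla Φ (Fin k) ρ - withAncilla Ψ (Fin k) ρ))

/-- The map `ρ ↦ K ρ Kᴴ`; for a unitary or an isometry `K` this is the corresponding channel. -/
def conjMap {a b : Type*} [Fintype a] (K : Matrix b a ℂ) : Op a →ₗ[ℂ] Op b where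
  toFun ρ := K * ρ * K.conjTranspose
  map_add' ρ σ := by rw [Matrix.mul_add, Matrix.add_mul]
  map_smul' c ρ := by rw [Matrix.mul_smul, Matrix.smul_mul, RingHom.id_apply]

/-- The tensor product `⨂ j, Λ j` of linear maps acting on different systems. The basis of
`⨂ j, ℂ^a` is labelled by `ι → a`; the operator `ρ` is expanded in products of matrix units. -/
def tensorMap {ι a b : Type*} [Fintype ι] [DecidableEq ι] [Fintype a] [DecidableEq a]
    (Λ : ι → Op a →ₗ[ℂ] Op b) : Op (ι → a) →ₗ[ℂ] Op (ι → b) where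
  toFun ρ := Matrix.of fun x y =>
    ∑ u : ι → a, ∑ v : ι → a,
      ρ u v * ∏ j, Λ j (Matrix.single (u j) (v j) 1) (x j) (y j)
  map_add' ρ σ := by
    ext x y
    simp [add_mul, Finset.sum_add_distrib]
  map_smul' c ρ := by
    ext x y
    simp [mul_assoc, Finset.mul_sum]

/-- The product operator `⨂ j, A j`. -/
def tensorOp {ι a : Type*} [Fintype ι] (A : ι → Op a) : Op (ι → a) :=
  Matrix.of fun x y => ∏ j, A j (x j) (y j)

/-- `⨂ j, Λ j` sends `⨂ j, A j` to `⨂ j, Λ j (A j)`. -/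
theorem tensorMap_tensorOp {ι a b : Type*} [Fintype ι] [DecidableEq ι] [Fintype a]
    [DecidableEq a] (Λ : ι → Op a →ₗ[ℂ] Op b) (A : ι → Op a) :
    tensorMap Λ (tensorOp A) = tensorOp fun j => Λ j (A j) := by
  ext x y
  have h : ∀ j, Λ j (A j) (x j) (y j)
      = ∑ w : a × a, A j w.1 w.2 * Λ j (Matrix.single w.1 w.2 1) (x j) (y j) := by
    intro j
    conv_lhs => rw [Matrix.matrix_eq_sum_single (A j)]
    rw [Fintype.sum_prod_type]
    simp only [map_sum, Matrix.sum_apply]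
    refine Finset.sum_congr rfl fun u _ => Finset.sum_congr rfl fun v _ => ?_
    have hs : Matrix.single u v (A j u v) = A j u v • Matrix.single u v (1 : ℂ) := by
      rw [Matrix.smul_single, smul_eq_mul, mul_one]
    rw [hs, map_smul, Matrix.smul_apply, smul_eq_mul]
  simp only [tensorMap, tensorOp, LinearMap.coe_mk, AddHom.coe_mk, Matrix.of_apply, h]
  rw [Finset.prod_univ_sum, ← Fintype.sum_prod_type']
  simp only [Fintype.piFinset_univ, ← Finset.prod_mul_distrib]
  exact Fintype.sum_equiv (Equiv.arrowProdEquivProdArrow ι (fun _ => a) (fun _ => a)).symm _ _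
    fun _ => rfl

/-- The isometric inclusion `ℂ^a → ℂ^a ⊕ ℂ` of a system into the system enlarged by one erasure
flag, the basis element labelled `none`. -/
def flagInclusion (a : Type*) [DecidableEq a] : Matrix (Option a) a ℂ :=
  Matrix.of fun x i => if x = some i then 1 else 0

/-- The erasure channel of one system: every state is replaced by the erasure flag, which is
orthogonal to the system. -/
def erasure (a : Type*) [Fintype a] [DecidableEq a] : Op a →ₗ[ℂ] Op (Option a) where
  toFun ρ := ρ.trace • Matrix.single none none 1
  map_add' ρ σ := by rw [Matrix.trace_add, add_smul]
  map_smul' c ρ := by rw [Matrix.trace_smul, smul_assoc, RingHom.id_apply]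

/-- Independent erasures: each of the `n` qudits is erased with probability `p` and is left
unchanged with probability `1 - p`. -/
def independentErasure (d n : ℕ) (p : ℝ) :
    Op (Fin n → Fin d) →ₗ[ℂ] Op (Fin n → Option (Fin d)) :=
  tensorMap fun _ : Fin n =>
    ((1 - p : ℝ) : ℂ) • conjMap (flagInclusion (Fin d)) + ((p : ℝ) : ℂ) • erasure (Fin d)

/-- The transversal action `⨂ j, 𝒱_j` of `V`, where `𝒱_j` is `ρ ↦ V ρ Vᴴ` if the qudit `j`
belongs to `S` and the identity channel otherwise. -/
def transversal {d n : ℕ} (S : Finset (Fin n)) (V : Op (Fin d)) :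
    Op (Fin n → Fin d) →ₗ[ℂ] Op (Fin n → Fin d) :=
  tensorMap fun j => if j ∈ S then conjMap V else LinearMap.id

/-- The encoder `E` of one logical qudit into `n` qudits is `SU(d)`-covariant for the transversal
action on the qudits in `S`. -/
def IsCovariantEncoder {d n : ℕ} (S : Finset (Fin n))
    (E : Op (Fin d) →ₗ[ℂ] Op (Fin n → Fin d)) : Prop :=
  ∀ V ∈ Matrix.specialUnitaryGroup (Fin d) ℂ,
    E ∘ₗ conjMap V = transversal S V ∘ₗ E

/-- The error `ε_cov` of the code with encoder `E` and decoder `D` against the noise `C`: the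
worst diamond norm error, over all logical gates `V` in `SU(d)`, of the encoded, transversally
executed, corrupted and decoded gate. -/
def covError {d n : ℕ} {b : Type*} (S : Finset (Fin n))
    (E : Op (Fin d) →ₗ[ℂ] Op (Fin n → Fin d)) (D : Op b →ₗ[ℂ] Op (Fin d))
    (C : Op (Fin n → Fin d) →ₗ[ℂ] Op b) : ℝ≥0∞ :=
  ⨆ V ∈ Matrix.specialUnitaryGroup (Fin d) ℂ,
    diamondError (D ∘ₗ C ∘ₗ transversal S V ∘ₗ E) (conjMap V)

end CovariantCode

end

open CovariantCode

/-! A good code hides the logical state from the environment, but covariance leaks a charge to it.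
Take the generator diag(1, -1, 0, ...). A covariant encoder has Kraus operators of definite charge
(`charge_eq_of_isCovariantEncoder`, `exists_hasKraus_of_charge`), so the logical charge is the
physical charge on `S` plus a number known from the Kraus label. The environment estimates the
physical charge from the erased qudits: an erased basis state `c` counts as `H c / p`, any other
qudit as `0`. This estimator is unbiased and, by independence, its variance is at most n(1 - p)/p.

If the coherence between two basis states survives up to δ, their environments nearly coincide and
no observable of small variance can tell their charges apart. Applying Cauchy-Schwarz to the
estimation residual, which has mean zero, makes this quantitative (`charge_gap_sq_mul_le`): gap² (1
- δ)² ≤ 8 δ · variance. An error below the claimed bound, tested on the gate `V = 1` alone, gives δ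
= 4r and violates this inequality. -/

/-! ### Kraus operators and the Choi matrix -/

/-- The operators `K i` are Kraus operators of the map `Φ`. -/
def HasKraus {κ a b : Type*} [Fintype κ] [Fintype a] (Φ : Op a →ₗ[ℂ] Op b)
    (K : κ → Matrix b a ℂ) : Prop :=
  ∀ ρ, Φ ρ = ∑ i, K i * ρ * (K i).conjTranspose

theorem HasKraus.comp {κ ν a b c : Type*} [Fintype κ] [Fintype ν] [Fintype a] [Fintype b]
    {Φ : Op b →ₗ[ℂ] Op c} {Ψ : Op a →ₗ[ℂ] Op b} {K : κ → Matrix c b ℂ} {L : ν → Matrix b a ℂ}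
    (hΦ : HasKraus Φ K) (hΨ : HasKraus Ψ L) :
    HasKraus (Φ ∘ₗ Ψ) fun i : κ × ν => K i.1 * L i.2 := by
  intro ρ
  rw [LinearMap.comp_apply, hΦ, Fintype.sum_prod_type]
  refine Finset.sum_congr rfl fun i _ => ?_
  rw [hΨ, Matrix.mul_sum, Matrix.sum_mul]
  refine Finset.sum_congr rfl fun j _ => ?_
  simp only [Matrix.conjTranspose_mul, Matrix.mul_assoc]

theorem HasKraus.apply_single {κ a b : Type*} [Fintype κ] [Fintype a] [DecidableEq a]
    {Φ : Op a →ₗ[ℂ] Op b} {K : κ → Matrix b a ℂ} (h : HasKraus Φ K) (u v : a) (x y : b) :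
    Φ (Matrix.single u v 1) x y = ∑ i, K i x u * star (K i y v) := by
  rw [h, Matrix.sum_apply]
  refine Finset.sum_congr rfl fun i _ => ?_
  simp [Matrix.mul_apply, Matrix.single_apply, ite_and, Finset.sum_ite_eq]

theorem HasKraus.of_apply_single {κ a b : Type*} [Fintype κ] [Fintype a] [DecidableEq a]
    {Φ : Op a →ₗ[ℂ] Op b} {K : κ → Matrix b a ℂ}
    (h : ∀ u v x y, Φ (Matrix.single u v 1) x y = ∑ i, K i x u * star (K i y v)) :
    HasKraus Φ K := by
  have key : Φ = ∑ i, conjMap (K i) := by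
    refine Matrix.ext_linearMap _ fun u v => ?_
    refine LinearMap.ext_ring ?_
    ext x y
    have := h u v x y
    simp only [LinearMap.comp_apply, LinearMap.sum_apply, Matrix.sum_apply]
    refine this.trans (Finset.sum_congr rfl fun i _ => ?_)
    simp [conjMap, Matrix.mul_apply, Matrix.single_apply, ite_and, Finset.sum_ite_eq]
  intro ρ
  rw [key, LinearMap.sum_apply]
  rfl

/-- Kraus operators of a trace-preserving map resolve the identity. -/
theorem HasKraus.sum_star_mul {κ a b : Type*} [Fintype κ] [Fintype a] [DecidableEq a] [Fintype b]
    {Φ : Op a →ₗ[ℂ] Op b} {K : κ → Matrix b a ℂ} (h : HasKraus Φ K)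
    (hΦ : ∀ ρ : Op a, (Φ ρ).trace = ρ.trace) (u v : a) :
    ∑ i, ∑ x, star (K i x u) * K i x v = if u = v then 1 else 0 := by
  have h1 := hΦ (Matrix.single v u 1)
  rw [Matrix.trace] at h1
  simp only [Matrix.diag_apply, h.apply_single] at h1
  rw [Finset.sum_comm] at h1
  simp only [mul_comm (star _)]
  rw [h1]
  by_cases huv : u = v
  · subst huv; simp
  · rw [if_neg huv, Matrix.trace_single_eq_of_ne _ _ _ (Ne.symm huv)]

/-- Applying a channel in Kraus form preserves inner products summed over the environment. -/
theorem HasKraus.sum_star_mul_apply {κ a b : Type*} [Fintype κ] [Fintype a] [DecidableEq a]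
    [Fintype b] {Φ : Op a →ₗ[ℂ] Op b} {K : κ → Matrix b a ℂ} (h : HasKraus Φ K)
    (hΦ : ∀ ρ : Op a, (Φ ρ).trace = ρ.trace) (f g : a → ℂ) :
    ∑ i, ∑ x, star (∑ u, K i x u * f u) * ∑ v, K i x v * g v = ∑ u, star (f u) * g u := by
  have h1 : ∀ i x, star (∑ u, K i x u * f u) * ∑ v, K i x v * g v
      = ∑ u, ∑ v, star (f u) * g v * (star (K i x u) * K i x v) := by
    intro i x
    rw [star_sum, Finset.sum_mul_sum]
    refine Finset.sum_congr rfl fun u _ => Finset.sum_congr rfl fun v _ => ?_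
    rw [star_mul']
    ring
  simp only [h1]
  calc _ = ∑ u, ∑ v, star (f u) * g v * ∑ i, ∑ x, star (K i x u) * K i x v := by
        simp only [Finset.mul_sum]
        rw [Finset.sum_congr rfl fun i _ => Finset.sum_comm, Finset.sum_comm]
        refine Finset.sum_congr rfl fun u _ => ?_
        rw [Finset.sum_congr rfl fun i _ => Finset.sum_comm, Finset.sum_comm]
    _ = _ := by
        simp only [h.sum_star_mul hΦ, mul_ite, mul_one, mul_zero, Finset.sum_ite_eq,
          Finset.mem_univ, if_true]

/-- The Choi matrix of a channel is positive semidefinite. -/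
theorem choi_posSemidef {a b : Type*} [Fintype a] [DecidableEq a] [Fintype b]
    {Φ : Op a →ₗ[ℂ] Op b} (h : IsChannel Φ) :
    (Matrix.of fun x y : b × a => Φ (Matrix.single x.2 y.2 1) x.1 y.1).PosSemidef := by
  let e := Fintype.equivFin a
  -- The unnormalized maximally entangled vector.
  let v : a × Fin (Fintype.card a) → ℂ := fun z => if e z.1 = z.2 then 1 else 0
  have h1 := h.completelyPositive _ _ (Matrix.posSemidef_vecMulVec_self_star v)
  have h2 := h1.submatrix (fun x : b × a => (x.1, e x.2))
  convert h2 using 1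
  ext x y
  simp only [withAncilla, Matrix.of_apply, LinearMap.coe_mk, AddHom.coe_mk, Matrix.submatrix_apply]
  have h3 : (Matrix.of fun i j => Matrix.vecMulVec v (star v) (i, e x.2) (j, e y.2))
      = Matrix.single x.2 y.2 1 := by
    ext i j
    by_cases hi : i = x.2 <;> by_cases hj : j = y.2 <;>
      simp [Matrix.vecMulVec_apply, v, hi, hj, eq_comm]
  rw [h3]

/-- A channel whose matrix elements respect a charge has Kraus operators of definite charge. -/
theorem exists_hasKraus_of_charge {a b : Type*} [Fintype a] [DecidableEq a] [Fintype b]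
    {Φ : Op a →ₗ[ℂ] Op b} (h : IsChannel Φ) (L : b → a → ℤ)
    (hL : ∀ u v x y, Φ (Matrix.single u v 1) x y ≠ 0 → L x u = L y v) :
    ∃ (κ : Type) (_ : Fintype κ) (K : κ → Matrix b a ℂ) (c : κ → ℤ),
      HasKraus Φ K ∧ ∀ i x u, K i x u ≠ 0 → L x u = c i := by
  classical
  obtain ⟨m, f, hf⟩ := Matrix.posSemidef_iff_eq_sum_vecMulVec.mp (choi_posSemidef h)
  have hf' : ∀ u v x y, Φ (Matrix.single u v 1) x y = ∑ i, f i (x, u) * star (f i (y, v)) := by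
    intro u v x y
    have := congrFun (congrFun hf (x, u)) (y, v)
    simpa [Matrix.sum_apply, Matrix.vecMulVec_apply] using this
  let T : Finset ℤ := Finset.univ.image fun z : b × a => L z.1 z.2
  -- Each Choi vector `f i` is cut into its charge sectors. By `hL` the Choi matrix has no entries
  -- between different sectors, so dropping the cross terms leaves the map unchanged.
  refine ⟨Fin m × T, inferInstance,
    fun i => Matrix.of fun x u => if L x u = i.2 then f i.1 (x, u) else 0, fun i => i.2, ?_, ?_⟩
  · refine HasKraus.of_apply_single fun u v x y => ?_
    rw [Fintype.sum_prod_type]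
    have hxT : L x u ∈ T := Finset.mem_image.2 ⟨(x, u), Finset.mem_univ _, rfl⟩
    have hin : ∀ i, ∑ t : T, (if L x u = t then f i (x, u) else 0)
        * star (if L y v = t then f i (y, v) else 0)
        = if L x u = L y v then f i (x, u) * star (f i (y, v)) else 0 := by
      intro i
      rw [Fintype.sum_eq_single ⟨L x u, hxT⟩]
      · by_cases hxy : L y v = L x u
        · simp [hxy]
        · simp [hxy, Ne.symm hxy]
      · intro t ht
        rw [if_neg (fun hh => ht (Subtype.ext hh.symm)), zero_mul]
    simp only [Matrix.of_apply, hin]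
    by_cases hxy : L x u = L y v
    · simp only [hxy, if_true]
      exact hf' u v x y
    · simp only [hxy, if_false, Finset.sum_const_zero]
      by_contra hne
      exact hxy (hL u v x y hne)
  · intro i x u hne
    by_contra hc
    exact hne (by simp [hc])

theorem exists_hasKraus {a b : Type*} [Fintype a] [DecidableEq a] [Fintype b]
    {Φ : Op a →ₗ[ℂ] Op b} (h : IsChannel Φ) :
    ∃ (κ : Type) (_ : Fintype κ) (K : κ → Matrix b a ℂ), HasKraus Φ K := by
  obtain ⟨κ, i, K, -, hK, -⟩ :=
    exists_hasKraus_of_charge h (fun _ _ => 0) fun _ _ _ _ _ => rfl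
  exact ⟨κ, i, K, hK⟩

/-! ### Coherences and the diamond norm -/

/-- Each entry of a matrix is bounded by its trace norm. -/
theorem norm_apply_le_traceNorm {a : Type*} [Fintype a] [DecidableEq a] (A : Op a) (x y : a) :
    ‖A x y‖ ≤ traceNorm A := by
  have hH := Matrix.isHermitian_conjTranspose_mul_self A
  have h0 : 0 ≤ traceNorm A := Finset.sum_nonneg fun i _ => Real.sqrt_nonneg _
  -- The Frobenius norm lies between a single entry and the trace norm.
  have h1 : ∑ i, hH.eigenvalues i ≤ traceNorm A ^ 2 := by
    calc ∑ i, hH.eigenvalues i = ∑ i, Real.sqrt (hH.eigenvalues i) ^ 2 := by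
          refine Finset.sum_congr rfl fun i _ => (Real.sq_sqrt ?_).symm
          exact Matrix.eigenvalues_conjTranspose_mul_self_nonneg A i
      _ ≤ _ := Finset.sum_sq_le_sq_sum_of_nonneg fun i _ => Real.sqrt_nonneg _
  have h2 : (∑ i, hH.eigenvalues i : ℝ) = ∑ v, ∑ u, ‖A u v‖ ^ 2 := by
    have h3 := hH.trace_eq_sum_eigenvalues
    have h4 : ((∑ i, hH.eigenvalues i : ℝ) : ℂ) = ((∑ v, ∑ u, ‖A u v‖ ^ 2 : ℝ) : ℂ) := by
      push_cast
      refine h3.symm.trans ?_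
      simp [Matrix.trace, Matrix.mul_apply, Complex.conj_mul']
    exact_mod_cast h4
  have h5 : ‖A x y‖ ^ 2 ≤ traceNorm A ^ 2 := by
    refine le_trans ?_ (h2 ▸ h1)
    refine le_trans ?_ (Finset.single_le_sum (f := fun v => ∑ u, ‖A u v‖ ^ 2)
      (fun v _ => Finset.sum_nonneg fun u _ => sq_nonneg _) (Finset.mem_univ y))
    exact Finset.single_le_sum (f := fun u => ‖A u y‖ ^ 2)
      (fun u _ => sq_nonneg _) (Finset.mem_univ x)
  exact abs_le_of_sq_le_sq' h5 h0 |>.2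

/-- The entangled input on the span of two basis vectors detects the loss of coherence. -/
theorem norm_apply_single_sub_one_le {d : ℕ} {Φ : Op (Fin d) →ₗ[ℂ] Op (Fin d)} {u v : Fin d}
    {r : ℝ} (h : diamondError Φ LinearMap.id ≤ ENNReal.ofReal r) (hr : 0 ≤ r) :
    ‖Φ (Matrix.single u v 1) u v - 1‖ ≤ 4 * r := by
  -- The input is (|u,0⟩ + |v,1⟩)/√2. Its ancilla block (0, 1) is half of |u⟩⟨v|; with the ½ in
  -- `diamondError` this gives the constant 4.
  let f : Fin 2 → Fin d := ![u, v]
  let w : Fin d × Fin 2 → ℂ := fun z => if z.1 = f z.2 then 1 else 0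
  let ρ : Op (Fin d × Fin 2) := (1 / 2 : ℝ) • Matrix.vecMulVec w (star w)
  have hρ : IsState ρ := by
    refine ⟨(Matrix.posSemidef_vecMulVec_self_star w).smul (by norm_num), ?_⟩
    simp [ρ, Matrix.trace, Matrix.vecMulVec_apply, w, Fintype.sum_prod_type_right, f]
  have h1 : ENNReal.ofReal ((1 / 2 : ℝ) *
      traceNorm (withAncilla Φ (Fin 2) ρ - withAncilla LinearMap.id (Fin 2) ρ))
      ≤ ENNReal.ofReal r :=
    le_trans (le_iSup₂_of_le 2 ρ (le_iSup (fun _ : IsState ρ => ENNReal.ofReal ((1 / 2 : ℝ) *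
      traceNorm (withAncilla Φ (Fin 2) ρ - withAncilla LinearMap.id (Fin 2) ρ))) hρ)) h
  rw [ENNReal.ofReal_le_ofReal_iff hr] at h1
  have h2 := norm_apply_le_traceNorm
    (withAncilla Φ (Fin 2) ρ - withAncilla LinearMap.id (Fin 2) ρ) (u, 0) (v, 1)
  have h3 : (Matrix.of fun i j => ρ (i, 0) (j, 1)) = (1 / 2 : ℂ) • Matrix.single u v 1 := by
    ext i j
    by_cases hi : i = u <;> by_cases hj : j = v <;>
      simp [ρ, Matrix.vecMulVec_apply, w, f, hi, hj, eq_comm (a := u),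
        eq_comm (a := v)]
  have h4 : (withAncilla Φ (Fin 2) ρ - withAncilla LinearMap.id (Fin 2) ρ) (u, 0) (v, 1)
      = (1 / 2 : ℂ) * (Φ (Matrix.single u v 1) u v - 1) := by
    rw [Matrix.sub_apply]
    change Φ (Matrix.of fun i j => ρ (i, 0) (j, 1)) u v
      - (Matrix.of fun i j => ρ (i, 0) (j, 1)) u v = _
    rw [h3, map_smul]
    simp [mul_sub]
  rw [h4, norm_mul] at h2
  norm_num at h2
  linarith

/-! ### Moments of sums of independent variables -/

/-- The expectation of a sum of centred independent variables vanishes. -/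
theorem sum_prod_mul_sum_eq_zero {ι κ : Type*} [Fintype ι] [DecidableEq ι] [Fintype κ]
    (q f : ι → κ → ℝ) (hf : ∀ j, ∑ k, q j k * f j k = 0) (S : Finset ι) :
    ∑ w : ι → κ, (∏ j, q j (w j)) * ∑ j ∈ S, f j (w j) = 0 := by
  simp only [Finset.mul_sum]
  rw [Finset.sum_comm]
  refine Finset.sum_eq_zero fun i _ => ?_
  -- Written as one product over sites, the summand lets the expectation factorize; the factor at
  -- site `i` is a vanishing mean.
  have h : ∀ w : ι → κ, (∏ j, q j (w j)) * f i (w i)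
      = ∏ j, q j (w j) * (if j = i then f j (w j) else 1) := by
    intro w
    rw [Finset.prod_mul_distrib, Finset.prod_ite_eq' Finset.univ i fun j => f j (w j)]
    simp
  simp only [h]
  rw [← Fintype.prod_sum fun j k => q j k * (if j = i then f j k else 1)]
  exact Finset.prod_eq_zero (Finset.mem_univ i) (by simpa using hf i)

/-- The second moment of a sum of centred independent variables is the sum of the variances. -/
theorem sum_prod_mul_sum_sq {ι κ : Type*} [Fintype ι] [DecidableEq ι] [Fintype κ]
    (q f : ι → κ → ℝ) (hq : ∀ j, ∑ k, q j k = 1) (hf : ∀ j, ∑ k, q j k * f j k = 0)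
    (S : Finset ι) :
    ∑ w : ι → κ, (∏ j, q j (w j)) * (∑ j ∈ S, f j (w j)) ^ 2
      = ∑ j ∈ S, ∑ k, q j k * f j k ^ 2 := by
  have h : ∀ i l, ∑ w : ι → κ, (∏ j, q j (w j)) * (f i (w i) * f l (w l))
      = if i = l then ∑ k, q i k * f i k ^ 2 else 0 := by
    intro i l
    have h1 : ∀ w : ι → κ, (∏ j, q j (w j)) * (f i (w i) * f l (w l))
        = ∏ j, q j (w j) * ((if j = i then f j (w j) else 1)
          * (if j = l then f j (w j) else 1)) := by
      intro w
      rw [Finset.prod_mul_distrib, Finset.prod_mul_distrib,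
        Finset.prod_ite_eq' Finset.univ i fun j => f j (w j),
        Finset.prod_ite_eq' Finset.univ l fun j => f j (w j)]
      simp
    simp only [h1]
    rw [← Fintype.prod_sum fun j k => q j k * ((if j = i then f j k else 1)
          * (if j = l then f j k else 1))]
    split_ifs with hil
    · subst hil
      rw [Finset.prod_eq_single i]
      · simp [pow_two]
      · intro j _ hj
        simpa [hj] using hq j
      · simp
    · refine Finset.prod_eq_zero (Finset.mem_univ i) ?_
      simpa [hil] using hf i
  simp only [pow_two (∑ j ∈ S, _)]
  simp only [Finset.sum_mul_sum]
  simp only [Finset.mul_sum]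
  rw [Finset.sum_comm]
  refine Finset.sum_congr rfl fun i hi => ?_
  rw [Finset.sum_comm]
  simp only [h, Finset.sum_ite_eq, if_pos hi]

/-! ### Erasures and the charge they reveal -/

/-- Kraus operators of a single-qudit erasure with probability `p`: `none` labels the event that
nothing happens and `some c` the erasure of the basis state `c`. -/
noncomputable def erasureKraus {a : Type*} [DecidableEq a] (p : ℝ) :
    Option a → Option a → a → ℝ
  | none, y, u => if y = some u then Real.sqrt (1 - p) else 0
  | some c, y, u => if y = none ∧ u = c then Real.sqrt p else 0

/-- The probability of the event labelled by `w` on the basis state `u`. -/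
noncomputable def erasureWeight {a : Type*} [DecidableEq a] (p : ℝ) (u : a) : Option a → ℝ
  | none => 1 - p
  | some c => if u = c then p else 0

/-- Each event sends distinct basis states to orthogonal vectors, possibly zero, so later inner
products reduce to classical probabilities. -/
theorem sum_erasureKraus_mul {a : Type*} [Fintype a] [DecidableEq a] {p : ℝ} (h0 : 0 ≤ p)
    (h1 : p ≤ 1) (w : Option a) (u v : a) :
    ∑ y, erasureKraus p w y u * erasureKraus p w y v
      = if u = v then erasureWeight p u w else 0 := by
  rw [Fintype.sum_option]
  cases w with
  | none =>
    by_cases huv : u = v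
    · subst huv
      simp [erasureKraus, erasureWeight, Real.mul_self_sqrt (sub_nonneg.2 h1), eq_comm]
    · simp [erasureKraus, huv, eq_comm]
  | some c =>
    by_cases huv : u = v
    · subst huv
      by_cases huc : u = c <;> simp [erasureKraus, erasureWeight, Real.mul_self_sqrt h0, huc]
    · by_cases huc : u = c
      · subst huc
        simp [erasureKraus, huv, Ne.symm huv]
      · simp [erasureKraus, huv, huc]

theorem sum_erasureWeight {a : Type*} [Fintype a] [DecidableEq a] (p : ℝ) (u : a) :
    ∑ w, erasureWeight p u w = 1 := by
  simp [Fintype.sum_option, erasureWeight]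

/-- The part of the generator `H` on one qudit that the environment cannot simulate: having
received the qudit in the state `c`, it guesses `H c / p`. -/
noncomputable def chargeResidual {a : Type*} (p : ℝ) (H : a → ℤ) (u : a) : Option a → ℝ
  | none => H u
  | some c => H u - H c / p

/-- The factor 1/p in the guess compensates for its being made only with probability `p`. -/
theorem sum_erasureWeight_mul_chargeResidual {a : Type*} [Fintype a] [DecidableEq a] {p : ℝ}
    (hp : p ≠ 0) (H : a → ℤ) (u : a) :
    ∑ w, erasureWeight p u w * chargeResidual p H u w = 0 := by
  simp only [Fintype.sum_option, erasureWeight, chargeResidual, ite_mul, zero_mul, Finset.sum_ite_eq,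
    Finset.mem_univ, if_true]
  field_simp
  ring

/-- The two events contribute (1 - p)H² and (1 - p)²H²/p. -/
theorem sum_erasureWeight_mul_chargeResidual_sq {a : Type*} [Fintype a] [DecidableEq a] {p : ℝ}
    (hp : p ≠ 0) (H : a → ℤ) (u : a) :
    ∑ w, erasureWeight p u w * chargeResidual p H u w ^ 2 = (H u : ℝ) ^ 2 * ((1 - p) / p) := by
  simp only [Fintype.sum_option, erasureWeight, chargeResidual, ite_mul, zero_mul, Finset.sum_ite_eq,
    Finset.mem_univ, if_true]
  field_simp
  ring

/-- The Kraus operators of independent erasures. -/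
noncomputable def independentErasureKraus (d n : ℕ) (p : ℝ) (w : Fin n → Option (Fin d)) :
    Matrix (Fin n → Option (Fin d)) (Fin n → Fin d) ℂ :=
  Matrix.of fun y u => ((∏ j, erasureKraus p (w j) (y j) (u j) : ℝ) : ℂ)

theorem tensorMap_single {ι a b : Type*} [Fintype ι] [DecidableEq ι] [Fintype a] [DecidableEq a]
    (Λ : ι → Op a →ₗ[ℂ] Op b) (u v : ι → a) (x y : ι → b) :
    tensorMap Λ (Matrix.single u v 1) x y = ∏ j, Λ j (Matrix.single (u j) (v j) 1) (x j) (y j) := by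
  simp [tensorMap, Matrix.single_apply, ite_and]

/-- The one-qudit identity `hs` is multiplied over the sites; expanding the product of sums indexes
the Kraus operators by words of erasure events. -/
theorem hasKraus_independentErasure (d n : ℕ) {p : ℝ} (h0 : 0 ≤ p) (h1 : p ≤ 1) :
    HasKraus (independentErasure d n p) (independentErasureKraus d n p) := by
  refine HasKraus.of_apply_single fun u v x y => ?_
  have hs : ∀ (s t : Fin d) (x y : Option (Fin d)),
      (((1 - p : ℝ) : ℂ) • conjMap (flagInclusion (Fin d)) + ((p : ℝ) : ℂ) • erasure (Fin d))
        (Matrix.single s t 1) x y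
      = ((∑ w, erasureKraus p w x s * erasureKraus p w y t : ℝ) : ℂ) := by
    intro s t x y
    have hc : conjMap (flagInclusion (Fin d)) (Matrix.single s t 1) x y
        = if x = some s ∧ y = some t then 1 else 0 := by
      by_cases hx : x = some s <;> by_cases hy : y = some t <;>
        simp [conjMap, flagInclusion, Matrix.mul_apply, Matrix.single_apply, ite_and, hx, hy]
      refine Finset.sum_eq_zero fun z _ => ?_
      split_ifs <;> simp_all
    have he : erasure (Fin d) (Matrix.single s t 1) x y
        = if s = t ∧ x = none ∧ y = none then 1 else 0 := by
      by_cases hst : s = t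
      · subst hst
        simp [erasure, Matrix.single_apply, eq_comm]
      · simp [erasure, hst, Matrix.trace_single_eq_of_ne _ _ _ hst]
    rw [LinearMap.add_apply, LinearMap.smul_apply, LinearMap.smul_apply, Matrix.add_apply,
      Matrix.smul_apply, Matrix.smul_apply, hc, he, Fintype.sum_option]
    have hk : ∑ c, erasureKraus p (some c) x s * erasureKraus p (some c) y t
        = if s = t ∧ x = none ∧ y = none then p else 0 := by
      by_cases hx : x = none <;> by_cases hy : y = none <;> by_cases hst : s = t <;>
        simp [erasureKraus, hx, hy, hst, Real.mul_self_sqrt h0]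
    have hn : erasureKraus p none x s * erasureKraus p none y t
        = if x = some s ∧ y = some t then 1 - p else 0 := by
      by_cases hx : x = some s <;> by_cases hy : y = some t <;>
        simp [erasureKraus, hx, hy, Real.mul_self_sqrt (sub_nonneg.2 h1)]
    rw [hk, hn, Complex.ofReal_add]
    congr 1 <;> split_ifs <;> simp
  rw [independentErasure, tensorMap_single]
  simp only [hs]
  rw [← Complex.ofReal_prod,
    Fintype.prod_sum fun j w => erasureKraus p w (x j) (u j) * erasureKraus p w (y j) (v j)]
  simp only [independentErasureKraus, Matrix.of_apply, Complex.star_def, Complex.conj_ofReal,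
    Finset.prod_mul_distrib]
  push_cast
  rfl

/-- The inner product, over the outputs of one erasure event, of two unnormalized code vectors
is weighted by the probability of that event. -/
theorem sum_star_independentErasureKraus_mul (d n : ℕ) {p : ℝ} (h0 : 0 ≤ p) (h1 : p ≤ 1)
    (w : Fin n → Option (Fin d)) (f g : (Fin n → Fin d) → ℂ) :
    ∑ y, star (∑ u, independentErasureKraus d n p w y u * f u)
        * ∑ v, independentErasureKraus d n p w y v * g v
      = ∑ u, ((∏ j, erasureWeight p (u j) (w j) : ℝ) : ℂ) * (star (f u) * g u) := by
  have hB : ∀ u v, ∑ y, star (independentErasureKraus d n p w y u)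
      * independentErasureKraus d n p w y v
      = if u = v then ((∏ j, erasureWeight p (u j) (w j) : ℝ) : ℂ) else 0 := by
    intro u v
    simp only [independentErasureKraus, Matrix.of_apply, Complex.star_def, Complex.conj_ofReal,
      ← Complex.ofReal_mul, ← Complex.ofReal_sum, ← Finset.prod_mul_distrib]
    rw [← Fintype.prod_sum fun j y => erasureKraus p (w j) y (u j) * erasureKraus p (w j) y (v j)]
    simp only [sum_erasureKraus_mul h0 h1]
    split_ifs with huv
    · subst huv
      simp
    · obtain ⟨j, hj⟩ := Function.ne_iff.1 huv
      rw [Finset.prod_eq_zero (Finset.mem_univ j) (if_neg hj), Complex.ofReal_zero]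
  calc _ = ∑ y, ∑ u, ∑ v, star (f u) * g v * (star (independentErasureKraus d n p w y u)
      * independentErasureKraus d n p w y v) := by
        refine Finset.sum_congr rfl fun y _ => ?_
        rw [star_sum, Finset.sum_mul_sum]
        refine Finset.sum_congr rfl fun u _ => Finset.sum_congr rfl fun v _ => ?_
        rw [star_mul']
        ring
    _ = ∑ u, ∑ v, star (f u) * g v * ∑ y, star (independentErasureKraus d n p w y u)
      * independentErasureKraus d n p w y v := by
        rw [Finset.sum_comm]
        refine Finset.sum_congr rfl fun u _ => ?_
        rw [Finset.sum_comm]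
        simp only [Finset.mul_sum]
    _ = _ := by
        simp only [hB, mul_ite, mul_zero, Finset.sum_ite_eq, Finset.mem_univ, if_true]
        exact Finset.sum_congr rfl fun u _ => mul_comm _ _

/-! ### Preserved coherence against knowledge of the charge -/

theorem norm_sum_star_mul_sq_le {ι : Type*} [Fintype ι] (f g : ι → ℂ) :
    ‖∑ i, star (f i) * g i‖ ^ 2 ≤ (∑ i, ‖f i‖ ^ 2) * ∑ i, ‖g i‖ ^ 2 := by
  refine le_trans ?_ (Finset.sum_mul_sq_le_sq_mul_sq Finset.univ (fun i => ‖f i‖) fun i => ‖g i‖)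
  refine pow_le_pow_left₀ (norm_nonneg _) ((norm_sum_le _ _).trans_eq ?_) 2
  exact Finset.sum_congr rfl fun i _ => by rw [norm_mul, norm_star]

/-- If the Kraus operators `T` nearly preserve the coherence between two basis states, then a
family `X` that is orthogonal to `T` on one of them has a small overlap with the other. -/
theorem norm_sum_star_mul_sq_le_of_coherence {μ a : Type*} [Fintype μ] [Fintype a] [DecidableEq a]
    (T X : μ → Matrix a a ℂ) {u v : a} {α δ : ℝ}
    (hTu : ∑ m, ∑ x, ‖T m x u‖ ^ 2 = 1) (hTv : ∑ m, ∑ x, ‖T m x v‖ ^ 2 = 1)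
    (hX : ∑ m, ∑ x, star (T m x u) * X m x u = 0) (hα : ∑ m, ∑ x, ‖X m x u‖ ^ 2 ≤ α)
    (hδ : 1 - δ ≤ (∑ m, star (T m v v) * T m u u).re) :
    ‖∑ m, star (T m v v) * X m u u‖ ^ 2 ≤ 2 * δ * α := by
  -- `f` compares the actual image of `u` with `u` tensored with the environment vector left by `v`.
  -- Orthogonality `hX` makes the subtracted term free, and ‖f‖² ≤ 1 + 1 - 2(1 - δ).
  let f : μ × a → ℂ := fun z => (if z.2 = u then T z.1 v v else 0) - T z.1 z.2 u
  have h1 : ∑ z, star (f z) * X z.1 z.2 u = ∑ m, star (T m v v) * X m u u := by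
    have h2 : ∀ m, ∑ x, star (f (m, x)) * X m x u
        = star (T m v v) * X m u u - ∑ x, star (T m x u) * X m x u := by
      intro m
      simp [f, sub_mul, Finset.sum_sub_distrib, apply_ite]
    rw [Fintype.sum_prod_type]
    simp only [h2, Finset.sum_sub_distrib, hX, sub_zero]
  have h3 : ∑ z, ‖f z‖ ^ 2 ≤ 2 * δ := by
    have h4 : ∀ m, ∑ x, ‖f (m, x)‖ ^ 2
        = ∑ x, ‖T m x u‖ ^ 2 + (‖T m v v‖ ^ 2 - 2 * (star (T m v v) * T m u u).re) := by
      intro m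
      have h5 : ∀ x, ‖f (m, x)‖ ^ 2 = ‖T m x u‖ ^ 2
          + if x = u then ‖T m v v‖ ^ 2 - 2 * (star (T m v v) * T m u u).re else 0 := by
        intro x
        by_cases hx : x = u
        · subst hx
          simp only [f, if_true, ← Complex.normSq_eq_norm_sq, Complex.normSq_apply,
            Complex.sub_re, Complex.sub_im, Complex.mul_re, Complex.star_def, Complex.conj_re,
            Complex.conj_im]
          ring
        · simp [f, hx]
      simp only [h5, Finset.sum_add_distrib, Finset.sum_ite_eq', Finset.mem_univ, if_true]
    rw [Fintype.sum_prod_type]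
    simp only [h4, Finset.sum_add_distrib, Finset.sum_sub_distrib, hTu, ← Finset.mul_sum,
      ← Complex.re_sum]
    have h6 : ∑ m, ‖T m v v‖ ^ 2 ≤ 1 := by
      rw [← hTv]
      exact Finset.sum_le_sum fun m _ => Finset.single_le_sum (f := fun x => ‖T m x v‖ ^ 2)
        (fun x _ => sq_nonneg _) (Finset.mem_univ v)
    linarith
  rw [← h1]
  refine (norm_sum_star_mul_sq_le f fun z => X z.1 z.2 u).trans ?_
  rw [Fintype.sum_prod_type (f := fun z : μ × a => ‖X z.1 z.2 u‖ ^ 2)]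
  have h7 : 0 ≤ ∑ z, ‖f z‖ ^ 2 := Finset.sum_nonneg fun z _ => sq_nonneg _
  have h8 : 0 ≤ ∑ m, ∑ x, ‖X m x u‖ ^ 2 :=
    Finset.sum_nonneg fun m _ => Finset.sum_nonneg fun x _ => sq_nonneg _
  exact mul_le_mul h3 hα h8 (h7.trans h3)

/-- If the generator `H` is reproduced, up to a residual `X` of mean zero and second moment `α`,
by an observable `h` of the environment, then the coherence between basis states of different
charge cannot be well preserved. -/
theorem charge_gap_sq_mul_le {μ a : Type*} [Fintype μ] [Fintype a] [DecidableEq a]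
    (T X : μ → Matrix a a ℂ) (h : μ → ℝ) (H : a → ℤ) {u v : a} {α δ : ℝ}
    (hdef : ∀ m x y, X m x y = ((H y : ℝ) - h m : ℝ) * T m x y)
    (hT : ∀ y, ∑ m, ∑ x, ‖T m x y‖ ^ 2 = 1)
    (hX : ∀ y, ∑ m, ∑ x, star (T m x y) * X m x y = 0)
    (hα : ∀ y, ∑ m, ∑ x, ‖X m x y‖ ^ 2 ≤ α)
    (hδ : ‖∑ m, T m u u * star (T m v v) - 1‖ ≤ δ) (hδ1 : δ ≤ 1) :
    ((H u : ℝ) - H v) ^ 2 * (1 - δ) ^ 2 ≤ 8 * δ * α := by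
  set z := ∑ m, T m u u * star (T m v v) with hz
  have hre : 1 - δ ≤ z.re := by
    have h1 := (Complex.abs_re_le_norm (z - 1)).trans hδ
    rw [Complex.sub_re, Complex.one_re] at h1
    linarith [(abs_le.1 h1).1]
  have hvu : ∑ m, star (T m v v) * T m u u = z := by simp only [hz, mul_comm]
  have huv : ∑ m, star (T m u u) * T m v v = star z := by
    simp only [hz, star_sum, star_mul', star_star]
  have h1 := norm_sum_star_mul_sq_le_of_coherence T X (hT u) (hT v) (hX u) (hα u) (δ := δ)
    (by rw [hvu]; exact hre)
  have h2 := norm_sum_star_mul_sq_le_of_coherence T X (hT v) (hT u) (hX v) (hα v) (δ := δ)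
    (by rw [huv]; exact hre)
  set p := ∑ m, star (T m v v) * X m u u with hp
  set q := ∑ m, star (T m u u) * X m v v with hq
  -- The estimate `h m` is real and common to both terms, so it cancels and only the charge gap
  -- remains.
  have h3 : p - star q = (((H u : ℝ) - H v : ℝ) : ℂ) * z := by
    rw [hp, hq, hz, star_sum, ← Finset.sum_sub_distrib, Finset.mul_sum]
    refine Finset.sum_congr rfl fun m _ => ?_
    simp only [hdef, star_mul', Complex.star_def, Complex.conj_ofReal, Complex.conj_conj]
    push_cast
    ring
  have h4 : |(H u : ℝ) - H v| * ‖z‖ ≤ ‖p‖ + ‖q‖ := by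
    rw [← Real.norm_eq_abs, ← Complex.norm_real, ← norm_mul, ← h3]
    exact (norm_sub_le _ _).trans_eq (by rw [norm_star])
  have h5 : |(H u : ℝ) - H v| * (1 - δ) ≤ ‖p‖ + ‖q‖ :=
    (mul_le_mul_of_nonneg_left (hre.trans (Complex.re_le_norm z)) (abs_nonneg _)).trans h4
  have h6 := pow_le_pow_left₀ (mul_nonneg (abs_nonneg _) (sub_nonneg.2 hδ1)) h5 2
  rw [mul_pow, sq_abs] at h6
  -- (‖p‖ + ‖q‖)² ≤ 2(‖p‖² + ‖q‖²), each square being at most 2δα.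
  nlinarith [sq_nonneg (‖p‖ - ‖q‖)]

/-! ### Charge conservation by a covariant encoder -/

/-- The total charge, on the qudits in `S`, of a basis state. -/
def totalCharge {ι a : Type*} (S : Finset ι) (H : a → ℤ) (x : ι → a) : ℤ :=
  ∑ j ∈ S, H (x j)

/-- A covariant encoder respects the charge generated by an integral diagonal generator. -/
theorem charge_eq_of_isCovariantEncoder {d n : ℕ} {S : Finset (Fin n)}
    {E : Op (Fin d) →ₗ[ℂ] Op (Fin n → Fin d)} (hcov : IsCovariantEncoder S E)
    {H : Fin d → ℤ} (hH : ∑ u, H u = 0) (u v : Fin d) (x y : Fin n → Fin d)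
    (hne : E (Matrix.single u v 1) x y ≠ 0) :
    H u - totalCharge S H x = H v - totalCharge S H y := by
  let c : ℤ → ℂ := fun k => Complex.exp (k * Complex.I)
  have hstar : ∀ k, star (c k) = c (-k) := by
    intro k
    simp only [c, Complex.star_def]
    rw [← Complex.exp_conj]
    simp
  have hadd : ∀ k l, c k * c l = c (k + l) := by
    intro k l
    simp only [c]
    rw [← Complex.exp_add]
    push_cast
    ring_nf
  have hone : c 0 = 1 := by simp [c]
  have hprod : ∀ {ι : Type} (s : Finset ι) (f : ι → ℤ), ∏ i ∈ s, c (f i) = c (∑ i ∈ s, f i) := by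
    intro ι s f
    simp only [c]
    rw [← Complex.exp_sum, Int.cast_sum, Finset.sum_mul]
  -- The single gate exp(iH) suffices; `hH` gives it determinant one.
  let V : Op (Fin d) := Matrix.diagonal fun u => c (H u)
  have hV : V ∈ Matrix.specialUnitaryGroup (Fin d) ℂ := by
    rw [Matrix.mem_specialUnitaryGroup_iff, Matrix.mem_unitaryGroup_iff]
    constructor
    · rw [Matrix.star_eq_conjTranspose, Matrix.diagonal_conjTranspose, Matrix.diagonal_mul_diagonal,
        ← Matrix.diagonal_one]
      congr 1
      ext u
      simp [hstar, hadd, hone]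
    · rw [Matrix.det_diagonal, hprod, hH, hone]
  have hconj : ∀ u v : Fin d, conjMap V (Matrix.single u v 1)
      = c (H u - H v) • Matrix.single u v 1 := by
    intro u v
    ext x y
    simp only [conjMap, LinearMap.coe_mk, AddHom.coe_mk, V, Matrix.diagonal_conjTranspose,
      Matrix.mul_diagonal, Matrix.diagonal_mul, Matrix.smul_apply, Matrix.single_apply]
    split_ifs with h
    · rw [h.1, h.2, Pi.star_apply, hstar, mul_one, hadd, smul_eq_mul, mul_one, sub_eq_add_neg]
    · simp
  have htrans : ∀ (ρ : Op (Fin n → Fin d)), transversal S V ρ x y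
      = c (totalCharge S H x - totalCharge S H y) * ρ x y := by
    intro ρ
    have h1 : ∀ u v : Fin n → Fin d,
        ∏ j, (if j ∈ S then conjMap V else LinearMap.id) (Matrix.single (u j) (v j) 1) (x j) (y j)
        = if u = x ∧ v = y then c (totalCharge S H x - totalCharge S H y) else 0 := by
      intro u v
      split_ifs with h
      · obtain ⟨rfl, rfl⟩ := h
        have h2 : ∀ j, (if j ∈ S then conjMap V else LinearMap.id)
            (Matrix.single (u j) (v j) 1) (u j) (v j)
            = if j ∈ S then c (H (u j) - H (v j)) else 1 := by
          intro j
          split_ifs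
          · rw [hconj]; simp
          · simp
        simp only [h2]
        rw [Finset.prod_ite_mem, Finset.univ_inter, hprod, Finset.sum_sub_distrib]
        rfl
      · have h3 : ∃ j, ¬ (u j = x j ∧ v j = y j) := by
          by_contra hall
          push Not at hall
          exact h ⟨funext fun j => (hall j).1, funext fun j => (hall j).2⟩
        obtain ⟨j, hj⟩ := h3
        refine Finset.prod_eq_zero (Finset.mem_univ j) ?_
        split_ifs
        · rw [hconj]; simp [hj]
        · simp [hj]
    simp only [transversal, tensorMap, LinearMap.coe_mk, AddHom.coe_mk, Matrix.of_apply, h1]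
    simp [ite_and, mul_comm]
  have h1 := congrFun (congrFun (LinearMap.congr_fun (hcov V hV) (Matrix.single u v 1)) x) y
  rw [LinearMap.comp_apply, LinearMap.comp_apply, hconj, map_smul, Matrix.smul_apply, htrans,
    smul_eq_mul] at h1
  have h2 := mul_right_cancel₀ hne h1
  set k := H u - H v with hk
  set l := totalCharge S H x - totalCharge S H y with hl
  have h3 : c (k - l) = 1 := by
    rw [sub_eq_add_neg, ← hadd, h2, hadd, add_neg_cancel, hone]
  obtain ⟨m, hm⟩ := Complex.exp_eq_one_iff.1 h3
  have h4 : ((k - l : ℤ) : ℝ) = m * (2 * Real.pi) := by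
    have := congrArg Complex.im hm
    simpa using this
  -- An integer equal to 2πm forces m = 0 by irrationality of π, so unit phases separate integral
  -- charges.
  have h5 : m = 0 := by
    by_contra hm0
    refine irrational_pi ⟨((k - l : ℤ) : ℚ) / (2 * m), ?_⟩
    have : (m : ℝ) ≠ 0 := by exact_mod_cast hm0
    rw [Rat.cast_div, Rat.cast_intCast, h4]
    push_cast
    field_simp
  rw [h5, Int.cast_zero, zero_mul] at h4
  have h6 : k - l = 0 := by exact_mod_cast h4
  omega

/-! ### The tradeoff for covariant codes -/

/-- What the environment learns about the charge on `S` from the erased qudits. -/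
noncomputable def erasedChargeEstimate {ι a : Type*} (S : Finset ι) (p : ℝ) (H : a → ℤ)
    (w : ι → Option a) : ℝ :=
  ∑ j ∈ S, (w j).elim 0 fun c => (H c : ℝ) / p

theorem totalCharge_sub_erasedChargeEstimate {ι a : Type*} (S : Finset ι) (p : ℝ) (H : a → ℤ)
    (w : ι → Option a) (x : ι → a) :
    (totalCharge S H x : ℝ) - erasedChargeEstimate S p H w
      = ∑ j ∈ S, chargeResidual p H (x j) (w j) := by
  rw [totalCharge, erasedChargeEstimate, Int.cast_sum, ← Finset.sum_sub_distrib]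
  refine Finset.sum_congr rfl fun j _ => ?_
  cases w j <;> simp [chargeResidual]

/-- Kraus operators of an encoder `L`, followed by erasures and a decoder `K`, in which the basis
states of the code are rescaled by a function `f` of the erasure event. -/
noncomputable def rescaledKraus {d n : ℕ} {a b κ ν : Type*} (p : ℝ)
    (K : κ → Matrix b (Fin n → Option (Fin d)) ℂ) (L : ν → Matrix (Fin n → Fin d) a ℂ)
    (f : (Fin n → Option (Fin d)) → (Fin n → Fin d) → ℝ)
    (m : κ × (Fin n → Option (Fin d)) × ν) : Matrix b a ℂ :=
  Matrix.of fun x z => ∑ y, K m.1 x y * ∑ u, independentErasureKraus d n p m.2.1 y u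
    * ((f m.2.1 u : ℂ) * L m.2.2 u z)

theorem rescaledKraus_one {d n : ℕ} {a b κ ν : Type*} (p : ℝ)
    (K : κ → Matrix b (Fin n → Option (Fin d)) ℂ) (L : ν → Matrix (Fin n → Fin d) a ℂ) :
    rescaledKraus p K L 1 = fun m => K m.1 * (independentErasureKraus d n p m.2.1 * L m.2.2) := by
  ext m x z
  simp [rescaledKraus, Matrix.mul_apply]

/-- Inner products, over output and environment, of the images of a logical basis state. -/
theorem sum_star_rescaledKraus_mul {d n : ℕ} {a b κ ν : Type*} [Fintype b] [Fintype κ] [Fintype ν]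
    {p : ℝ} (h0 : 0 ≤ p) (h1 : p ≤ 1)
    {D : Op (Fin n → Option (Fin d)) →ₗ[ℂ] Op b} (hD : ∀ ρ, (D ρ).trace = ρ.trace)
    {K : κ → Matrix b (Fin n → Option (Fin d)) ℂ} (hK : HasKraus D K)
    (L : ν → Matrix (Fin n → Fin d) a ℂ)
    (f g : (Fin n → Option (Fin d)) → (Fin n → Fin d) → ℝ) (z : a) :
    ∑ m, ∑ x, star (rescaledKraus p K L f m x z) * rescaledKraus p K L g m x z
    = ∑ i, ∑ u, star (L i u z) * L i u z
        * ((∑ w : Fin n → Option (Fin d), (∏ j, erasureWeight p (u j) (w j))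
          * (f w u * g w u) : ℝ) : ℂ) := by
  simp only [rescaledKraus, Matrix.of_apply]
  rw [Fintype.sum_prod_type, Finset.sum_comm]
  simp only [hK.sum_star_mul_apply hD]
  rw [Fintype.sum_prod_type, Finset.sum_comm]
  refine Finset.sum_congr rfl fun i _ => ?_
  simp only [sum_star_independentErasureKraus_mul d n h0 h1]
  rw [Finset.sum_comm]
  refine Finset.sum_congr rfl fun u _ => ?_
  rw [Complex.ofReal_sum, Finset.mul_sum]
  refine Finset.sum_congr rfl fun w _ => ?_
  simp only [star_mul', Complex.star_def, Complex.conj_ofReal]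
  push_cast
  ring

theorem sum_norm_sq_eq_one_of_sum_star_mul {κ b : Type*} [Fintype κ] [Fintype b] {f : κ → b → ℂ}
    (h : ∑ i, ∑ x, star (f i x) * f i x = 1) : ∑ i, ∑ x, ‖f i x‖ ^ 2 = 1 := by
  have h1 : ((∑ i, ∑ x, ‖f i x‖ ^ 2 : ℝ) : ℂ) = 1 := by
    rw [← h]
    push_cast
    simp only [Complex.star_def, Complex.conj_mul']
  exact_mod_cast h1

/-- The tradeoff between the charge carried by the logical system and the coherence preserved by
a covariant code under independent erasures. -/
theorem charge_gap_sq_mul_le_of_isCovariantEncoder {d n : ℕ} {p : ℝ} (h0 : 0 < p) (h1 : p ≤ 1)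
    {S : Finset (Fin n)} {E : Op (Fin d) →ₗ[ℂ] Op (Fin n → Fin d)}
    {D : Op (Fin n → Option (Fin d)) →ₗ[ℂ] Op (Fin d)} (hE : IsChannel E) (hD : IsChannel D)
    (hcov : IsCovariantEncoder S E) {H : Fin d → ℤ} (hH : ∑ u, H u = 0) (hH1 : ∀ u, |H u| ≤ 1)
    {u v : Fin d} {δ : ℝ} (hδ1 : δ ≤ 1)
    (hδ : ‖(D ∘ₗ independentErasure d n p ∘ₗ E) (Matrix.single u v 1) u v - 1‖ ≤ δ) :
    ((H u : ℝ) - H v) ^ 2 * (1 - δ) ^ 2 ≤ 8 * δ * (n * ((1 - p) / p)) := by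
  obtain ⟨ν, _, L, c, hL, hc⟩ := exists_hasKraus_of_charge hE
    (fun x u => H u - totalCharge S H x) fun u v x y => charge_eq_of_isCovariantEncoder hcov hH u v x y
  obtain ⟨κ, _, K, hK⟩ := exists_hasKraus hD
  let g : (Fin n → Option (Fin d)) → (Fin n → Fin d) → ℝ := fun w x =>
    ∑ j ∈ S, chargeResidual p H (x j) (w j)
  let q : (Fin n → Option (Fin d)) → (Fin n → Fin d) → ℝ := fun w x =>
    ∏ j, erasureWeight p (x j) (w j)
  -- Both terms are functions of the Kraus labels, hence available to the environment: the charge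
  -- offset of the encoder and the estimate from the erased qudits.
  let h : κ × (Fin n → Option (Fin d)) × ν → ℝ := fun m =>
    c m.2.2 + erasedChargeEstimate S p H m.2.1
  have hT : HasKraus (D ∘ₗ independentErasure d n p ∘ₗ E) (rescaledKraus p K L 1) := by
    rw [rescaledKraus_one]
    have h2 := (hasKraus_independentErasure d n h0.le h1).comp hL
    have h3 := hK.comp h2
    exact h3
  have hinner := sum_star_rescaledKraus_mul h0.le h1 hD.tracePreserving hK L
  have hdef : ∀ m x a, rescaledKraus p K L g m x a
      = ((H a : ℝ) - h m : ℝ) * rescaledKraus p K L 1 m x a := by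
    intro m x a
    simp only [rescaledKraus, Matrix.of_apply, Finset.mul_sum]
    refine Finset.sum_congr rfl fun y _ => Finset.sum_congr rfl fun u _ => ?_
    -- On the support of `L` the logical charge is the offset plus the physical charge, so the
    -- rescaling `g` equals H - h there.
    by_cases hne : L m.2.2 u a = 0
    · simp [hne]
    · have h2 : g m.2.1 u = (H a : ℝ) - h m := by
        simp only [g, h, ← totalCharge_sub_erasedChargeEstimate, ← hc _ _ _ hne]
        push_cast
        ring
      rw [h2, Pi.one_apply, Pi.one_apply]
      push_cast
      ring
  have hLone : ∀ a, ∑ i, ∑ u, star (L i u a) * L i u a = 1 := fun a => by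
    rw [hL.sum_star_mul hE.tracePreserving, if_pos rfl]
  have hp0 := h0.ne'
  have hqsum : ∀ x, ∑ w, q w x = 1 := by
    intro x
    simp only [q]
    rw [← Fintype.prod_sum fun j w => erasureWeight p (x j) w]
    exact Finset.prod_eq_one fun j _ => sum_erasureWeight p (x j)
  have hqg : ∀ x, ∑ w, q w x * g w x = 0 := fun x =>
    sum_prod_mul_sum_eq_zero (fun j w => erasureWeight p (x j) w)
      (fun j w => chargeResidual p H (x j) w)
      (fun j => sum_erasureWeight_mul_chargeResidual hp0 H (x j)) S
  have hqgg : ∀ x, ∑ w, q w x * (g w x * g w x) ≤ n * ((1 - p) / p) := by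
    intro x
    simp only [← pow_two]
    refine (sum_prod_mul_sum_sq (fun j w => erasureWeight p (x j) w)
      (fun j w => chargeResidual p H (x j) w) (fun j => sum_erasureWeight p (x j))
      (fun j => sum_erasureWeight_mul_chargeResidual hp0 H (x j)) S).trans_le ?_
    simp only [sum_erasureWeight_mul_chargeResidual_sq hp0]
    have hα : 0 ≤ (1 - p) / p := div_nonneg (sub_nonneg.2 h1) h0.le
    calc ∑ j ∈ S, (H (x j) : ℝ) ^ 2 * ((1 - p) / p) ≤ ∑ j ∈ S, (1 - p) / p := by
          refine Finset.sum_le_sum fun j _ => mul_le_of_le_one_left hα ?_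
          rw [sq_le_one_iff_abs_le_one]
          exact_mod_cast hH1 (x j)
      _ ≤ ∑ j : Fin n, (1 - p) / p :=
          Finset.sum_le_sum_of_subset_of_nonneg (Finset.subset_univ S) fun _ _ _ => hα
      _ = n * ((1 - p) / p) := by simp
  refine charge_gap_sq_mul_le _ _ h H hdef ?_ ?_ ?_ ?_ hδ1
  · intro a
    refine sum_norm_sq_eq_one_of_sum_star_mul (f := fun m x => rescaledKraus p K L 1 m x a) ?_
    rw [hinner, ← hLone a]
    refine Finset.sum_congr rfl fun i _ => Finset.sum_congr rfl fun u _ => ?_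
    simp only [Pi.one_apply, mul_one]
    rw [hqsum u, Complex.ofReal_one, mul_one]
  · intro a
    rw [hinner]
    refine Finset.sum_eq_zero fun i _ => Finset.sum_eq_zero fun u _ => ?_
    simp only [Pi.one_apply, one_mul]
    rw [hqg u, Complex.ofReal_zero, mul_zero]
  · intro a
    have h2 := hinner g g a
    have h3 : ∑ m, ∑ x, ‖rescaledKraus p K L g m x a‖ ^ 2
        = ∑ i, ∑ u, ‖L i u a‖ ^ 2 * ∑ w, q w u * (g w u * g w u) := by
      have h4 : ((∑ m, ∑ x, ‖rescaledKraus p K L g m x a‖ ^ 2 : ℝ) : ℂ)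
          = ((∑ i, ∑ u, ‖L i u a‖ ^ 2 * ∑ w, q w u * (g w u * g w u) : ℝ) : ℂ) := by
        simp only [Complex.star_def, Complex.conj_mul'] at h2
        simp only [Complex.ofReal_sum, Complex.ofReal_mul, Complex.ofReal_pow] at h2 ⊢
        exact h2
      exact_mod_cast h4
    rw [h3]
    calc _ ≤ ∑ i, ∑ u, ‖L i u a‖ ^ 2 * (n * ((1 - p) / p)) :=
          Finset.sum_le_sum fun i _ => Finset.sum_le_sum fun u _ =>
            mul_le_mul_of_nonneg_left (hqgg u) (sq_nonneg _)
      _ = _ := by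
          simp only [← Finset.sum_mul]
          rw [sum_norm_sq_eq_one_of_sum_star_mul (f := fun i u => L i u a) (hLone a), one_mul]
  · rw [← hT.apply_single]
    exact hδ

/-! ### The lower bound on the error -/

theorem proposition2 (d n : ℕ) (hd : 2 ≤ d) (hn : 1 ≤ n)
    (p : ℝ) (hp0 : 0 < p) (hp : p < 1 / 2)
    (S : Finset (Fin n))
    (E : Op (Fin d) →ₗ[ℂ] Op (Fin n → Fin d))
    (D : Op (Fin n → Option (Fin d)) →ₗ[ℂ] Op (Fin d))
    (hE : IsChannel E) (hD : IsChannel D)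
    (hcov : IsCovariantEncoder S E) :
    ENNReal.ofReal (p / (64 * (n : ℝ) * (1 - p)))
      ≤ covError S E D (independentErasure d n p) := by
  by_contra hlt
  set r := p / (64 * (n : ℝ) * (1 - p)) with hr
  have hn0 : (1 : ℝ) ≤ n := by exact_mod_cast hn
  have hr0 : 0 ≤ r := div_nonneg hp0.le (by nlinarith)
  have hone : conjMap (1 : Op (Fin d)) = LinearMap.id := by
    ext1 ρ
    simp [conjMap]
  have hdiamond : diamondError (D ∘ₗ independentErasure d n p ∘ₗ E) LinearMap.id
      ≤ ENNReal.ofReal r := by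
    have h1 : diamondError (D ∘ₗ independentErasure d n p ∘ₗ transversal S 1 ∘ₗ E) (conjMap 1)
        ≤ covError S E D (independentErasure d n p) :=
      le_iSup₂_of_le (1 : Op (Fin d)) (one_mem _) le_rfl
    -- Covariance at `V = 1` moves the trivial gate in front of the encoder, where it disappears.
    rw [← hcov 1 (one_mem _), hone, LinearMap.comp_id] at h1
    exact h1.trans (not_le.1 hlt).le
  let u : Fin d := ⟨0, by omega⟩
  let v : Fin d := ⟨1, by omega⟩
  have huv : u ≠ v := by simp [u, v]
  let H : Fin d → ℤ := fun a => (if a = u then 1 else 0) - if a = v then 1 else 0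
  have hH : ∑ a, H a = 0 := by simp [H, Finset.sum_sub_distrib]
  have hH1 : ∀ a, |H a| ≤ 1 := by
    intro a
    simp only [H]
    split_ifs <;> simp
  have hgap : (H u : ℝ) - H v = 2 := by
    simp [H, huv, huv.symm]
    norm_num
  have hrα : r * (n * ((1 - p) / p)) = 1 / 64 := by
    have : 1 - p ≠ 0 := by linarith
    rw [hr]
    field_simp
  -- Here p < 1/2 enters; it yields r ≤ 1/64, so δ = 4r ≤ 1/16.
  have hα : 1 ≤ n * ((1 - p) / p) := by
    have : 1 ≤ (1 - p) / p := by rw [le_div_iff₀ hp0]; linarith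
    nlinarith
  have hr64 : r ≤ 1 / 64 := by
    rw [← hrα]
    exact le_mul_of_one_le_right hr0 hα
  have h := charge_gap_sq_mul_le_of_isCovariantEncoder hp0 (by linarith) hE hD hcov hH hH1
    (by linarith : 4 * r ≤ 1) (norm_apply_single_sub_one_le (u := u) (v := v) hdiamond hr0)
  rw [hgap] at h
  -- The tradeoff reads 4(1 - 4r)² ≤ 32 · (1/64) = 1/2, but the left side is at least 4(15/16)² > 3.
  nlinarith
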